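/- Let $K$ be a field of any characteristic, let $X=\{x_i\mid i\in\mathcal I\}$ be a set of variables indexed by a well-ordered set $\mathcal I$ (for instance $X=\{x_1,x_2,\ldots\}$, finite or countable), and let $K\langle X\rangle$ be the free unitary associative $K$-algebra on $X$, with $[f,g]=fg-gf$. Let $L$ be the Lie subalgebra of $K\langle X\rangle$ generated by $X$ (the free Lie algebra on $X$), let $\gamma_3(L)=[[L,L],L]$ be the third term of its lower central series, and let $I=K\langle X\rangle\,\gamma_3(L)\,K\langle X\rangle$ be the two-sided ideal of $K\langle X\rangle$ generated by $\gamma_3(L)$. Order the words in $X$ by the deg-lex ordering: first by length, then lexicographically from left to right, where $x_i<x_j$ if $i<j$. For nonzero $f\in K\langle X\rangle$ let $\mathrm{lt}(f)$ be the greatest word occurring in $f$ with nonzero coefficient. A subset $G\subseteq I$ is a Gröbner basis of $I$ if for every nonzero $f\in I$ there is a nonzero $g\in G$ such that $\mathrm{lt}(g)$ is a (contiguous) subword of $\mathrm{lt}(f)$. Proposition. The set of all polynomials $$f'_{ij}=[[x_i,x_j],x_j],\qquad f''_{ij}=[x_i,[x_i,x_j]]\qquad (i>j),$$ $$g'_{ijk}=[x_i,[x_j,x_k]],\qquad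 g''_{ikj}=[[x_i,x_k],x_j]\qquad (i>j>k),$$ $$h_{ijk}=[[x_i,x_j],[x_i,x_k]]\qquad (i>j>k)$$ is a Gröbner basis of $I$ with respect to the deg-lex ordering. -/

import Mathlib

namespace FreeNilpotentGroebner

section Groebner

variable {K X : Type*} [Field K]

/-- The (finite) set of words occurring in `f ∈ K⟨X⟩` with a nonzero coefficient. -/
noncomputable def words (f : FreeAlgebra K X) : Finset (FreeMonoid X) :=
  (FreeAlgebra.equivMonoidAlgebraFreeMonoid f).coeff.support

/-- `w = lt(f)`: the word `w` occurs in `f` and is greater, with respect to the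
strict order `r` on words, than every other word occurring in `f`. -/
def IsLeadingWord (r : FreeMonoid X → FreeMonoid X → Prop)
    (f : FreeAlgebra K X) (w : FreeMonoid X) : Prop :=
  w ∈ words f ∧ ∀ v ∈ words f, v ≠ w → r v w

/-- `u` is a (contiguous) subword of `w`. -/
def IsSubword (u w : FreeMonoid X) : Prop :=
  ∃ a b : FreeMonoid X, w = a * u * b

/-- `G` is a Gröbner basis of the two-sided ideal `I` of `K⟨X⟩` with respect to the strict order
`r` on words: `G ⊆ I`, and the leading word of every nonzero `f ∈ I` has the leading word of some
`g ∈ G` as a subword. -/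
def IsGroebnerBasis (r : FreeMonoid X → FreeMonoid X → Prop)
    (G : Set (FreeAlgebra K X)) (I : TwoSidedIdeal (FreeAlgebra K X)) : Prop :=
  (∀ g ∈ G, g ∈ I) ∧
    ∀ f ∈ I, f ≠ 0 → ∃ w, IsLeadingWord r f w ∧
      ∃ g ∈ G, ∃ u, IsLeadingWord r g u ∧ IsSubword u w

end Groebner

/-- The strict deg-lex order on words: compare first by length, then lexicographically from left
to right. -/
def DegLexLT {X : Type*} [LinearOrder X] (u v : FreeMonoid X) : Prop :=
  List.Shortlex (· < ·) u.toList v.toList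

section Ideal

attribute [local instance 100] LieRing.ofAssociativeRing

variable (K X : Type*) [Field K]

/-- The free Lie algebra `L = L(X)`, as the Lie subalgebra of `K⟨X⟩` generated by `X` with respect
to the commutator `⁅f, g⁆ = f * g - g * f`. -/
def freeLie : LieSubalgebra K (FreeAlgebra K X) :=
  LieSubalgebra.lieSpan K (FreeAlgebra K X) (Set.range (FreeAlgebra.ι K))

/-- The third member `γ₃(L) = [L, L, L]` of the lower central series of `L`, as a subset of `K⟨X⟩`.
(The series is indexed from `0` in Mathlib: `γ₁(L) = L` is the term with index `0`.) -/
def gammaThree : Set (FreeAlgebra K X) :=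
  (fun a : freeLie K X => (a : FreeAlgebra K X)) ''
    (LieModule.lowerCentralSeries K (freeLie K X) (freeLie K X) 2 : Set (freeLie K X))

/-- The two-sided ideal `I = K⟨X⟩ γ₃(L) K⟨X⟩`. -/
def gammaThreeIdeal : TwoSidedIdeal (FreeAlgebra K X) :=
  TwoSidedIdeal.span (gammaThree K X)

end Ideal

section Commutators

variable (K : Type*) {X : Type*} [Field K]

/-- The variable `x_i` of `K⟨X⟩`. -/
abbrev x (i : X) : FreeAlgebra K X := FreeAlgebra.ι K i

/-- `f'_{ij} = [[x_i, x_j], x_j]`. -/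
def f' (i j : X) : FreeAlgebra K X := ⁅⁅x K i, x K j⁆, x K j⁆

/-- `f''_{ij} = [x_i, [x_i, x_j]]`. -/
def f'' (i j : X) : FreeAlgebra K X := ⁅x K i, ⁅x K i, x K j⁆⁆

/-- `g'_{ijk} = [x_i, [x_j, x_k]]`. -/
def g' (i j k : X) : FreeAlgebra K X := ⁅x K i, ⁅x K j, x K k⁆⁆

/-- `g''_{ikj} = [[x_i, x_k], x_j]` (the arguments are in the order `i`, `k`, `j`). -/
def g'' (i k j : X) : FreeAlgebra K X := ⁅⁅x K i, x K k⁆, x K j⁆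

/-- `h_{ijk} = [[x_i, x_j], [x_i, x_k]]`. -/
def h (i j k : X) : FreeAlgebra K X := ⁅⁅x K i, x K j⁆, ⁅x K i, x K k⁆⁆

variable (X) in
/-- The set of all `f'_{ij}`, `f''_{ij}` with `i > j` and all `g'_{ijk}`, `g''_{ikj}`, `h_{ijk}`
with `i > j > k`. -/
def commutators [LinearOrder X] : Set (FreeAlgebra K X) :=
  {p | ∃ i j : X, i > j ∧ (p = f' K i j ∨ p = f'' K i j)} ∪
    {p | ∃ i j k : X, i > j ∧ j > k ∧ (p = g' K i j k ∨ p = g'' K i k j ∨ p = h K i j k)}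

end Commutators

end FreeNilpotentGroebner

/-! Let x_i act on the polynomial ring in commuting variables x_i, c_{ij} as multiplication by x_i
plus the derivation sending x_j to c_{ij} for j < i. A commutator of two such operators is
multiplication by a polynomial in the c's, so it commutes with all of them, and the ideal acts by
zero (`modelHom_eq_zero`).

A word avoiding the listed leading words splits into single letters and descending pairs x_i x_j,
and so spells a monomial m of the model (`exists_leastWord`). Applied to 1, this word yields m with
coefficient 1 (`LeastWord.coeff_eq_one`). No lexicographically smaller word of the same length
yields m (`LeastWord.le`), and other lengths are excluded by degree. If such a word led an element f
of the ideal, the coefficient of m in f·1 = 0 would be the leading coefficient of f, a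
contradiction. The coefficient 1 makes this work in every characteristic, and no compositions have
to be reduced. -/

namespace FreeNilpotentGroebner

/-! ### Expansion of polynomials in words -/

section Words

variable {K X : Type*} [Field K]

variable (K) in
/-- The word `w` as an element of `K⟨X⟩`. -/
noncomputable def word (w : List X) : FreeAlgebra K X := (w.map (FreeAlgebra.ι K)).prod

@[simp]
theorem word_nil : word K ([] : List X) = 1 := rfl

@[simp]
theorem word_cons (i : X) (w : List X) : word K (i :: w) = FreeAlgebra.ι K i * word K w := by
  simp [word]

theorem equivMonoidAlgebraFreeMonoid_word (w : List X) :
    FreeAlgebra.equivMonoidAlgebraFreeMonoid (word K w) =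
      MonoidAlgebra.single (FreeMonoid.ofList w) 1 := by
  induction w with
  | nil => simp [MonoidAlgebra.one_def]
  | cons i w ih =>
    rw [word_cons, map_mul, ih]
    simp [FreeAlgebra.equivMonoidAlgebraFreeMonoid, MonoidAlgebra.of_apply,
      MonoidAlgebra.single_mul_single, FreeMonoid.ofList_cons]

variable (K) in
/-- The coefficient of the word `w` in a polynomial. -/
noncomputable def coeffWord (w : FreeMonoid X) : FreeAlgebra K X →ₗ[K] K where
  toFun f := (FreeAlgebra.equivMonoidAlgebraFreeMonoid f).coeff w
  map_add' f g := by simp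
  map_smul' c f := by simp

theorem mem_words {f : FreeAlgebra K X} {w : FreeMonoid X} :
    w ∈ words f ↔ coeffWord K w f ≠ 0 := by
  simp [words, coeffWord]

open Classical in
theorem coeffWord_word (w : FreeMonoid X) (v : List X) :
    coeffWord K w (word K v) = if v = w.toList then 1 else 0 := by
  simp only [coeffWord, LinearMap.coe_mk, AddHom.coe_mk, equivMonoidAlgebraFreeMonoid_word]
  rw [MonoidAlgebra.coeff_single, Finsupp.single_apply]
  exact if_congr Iff.rfl rfl rfl

theorem sum_words (f : FreeAlgebra K X) :
    f = ∑ w ∈ words f, coeffWord K w f • word K w.toList := by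
  apply FreeAlgebra.equivMonoidAlgebraFreeMonoid.injective
  simp only [map_sum, map_smul, equivMonoidAlgebraFreeMonoid_word, FreeMonoid.ofList_toList,
    MonoidAlgebra.smul_single, smul_eq_mul, mul_one]
  exact (MonoidAlgebra.sum_coeff_single _).symm

theorem words_nonempty {f : FreeAlgebra K X} (hf : f ≠ 0) : (words f).Nonempty := by
  rw [Finset.nonempty_iff_ne_empty]
  intro h
  apply hf
  rw [sum_words f, h, Finset.sum_empty]

end Words

/-! ### The deg-lex order and the leading words of the commutators -/

section Order

variable {K X : Type*} [Field K] [LinearOrder X]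

theorem degLexLT_iff {u v : FreeMonoid X} : DegLexLT u v ↔
    u.toList.length < v.toList.length ∨
      u.toList.length = v.toList.length ∧ u.toList < v.toList :=
  List.shortlex_def

theorem DegLexLT.trans {u v w : FreeMonoid X} (huv : DegLexLT u v) (hvw : DegLexLT v w) :
    DegLexLT u w := by
  rw [degLexLT_iff] at *
  rcases huv with h | ⟨h, h'⟩ <;> rcases hvw with k | ⟨k, k'⟩
  · exact .inl (h.trans k)
  · exact .inl (k ▸ h)
  · exact .inl (h ▸ k)
  · exact .inr ⟨h.trans k, h'.trans k'⟩

theorem DegLexLT.irrefl (u : FreeMonoid X) : ¬ DegLexLT u u := by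
  rw [degLexLT_iff]
  simp

theorem DegLexLT.total {u v : FreeMonoid X} (h : u ≠ v) : DegLexLT u v ∨ DegLexLT v u := by
  simp only [degLexLT_iff]
  rcases lt_trichotomy u.toList.length v.toList.length with h' | h' | h'
  · exact .inl (.inl h')
  · rcases lt_trichotomy u.toList v.toList with k | k | k
    · exact .inl (.inr ⟨h', k⟩)
    · exact absurd (FreeMonoid.toList.injective k) h
    · exact .inr (.inr ⟨h'.symm, k⟩)
  · exact .inr (.inl h')

theorem exists_greatest_word {s : Finset (FreeMonoid X)} (hs : s.Nonempty) :
    ∃ w ∈ s, ∀ v ∈ s, v ≠ w → DegLexLT v w := by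
  induction hs using Finset.Nonempty.cons_induction with
  | singleton a => exact ⟨a, by simp⟩
  | cons a s ha hs ih =>
    obtain ⟨w, hw, h⟩ := ih
    have haw : a ≠ w := fun e => ha (e ▸ hw)
    rcases DegLexLT.total haw with k | k
    · refine ⟨w, Finset.mem_cons_of_mem hw, fun v hv hvw => ?_⟩
      rcases Finset.mem_cons.mp hv with rfl | hv
      · exact k
      · exact h v hv hvw
    · refine ⟨a, Finset.mem_cons_self a s, fun v hv hva => ?_⟩
      rcases Finset.mem_cons.mp hv with rfl | hv
      · exact absurd rfl hva
      · by_cases e : v = w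
        · exact e ▸ k
        · exact (h v hv e).trans k

theorem exists_isLeadingWord {f : FreeAlgebra K X} (hf : f ≠ 0) :
    ∃ w, IsLeadingWord DegLexLT f w :=
  exists_greatest_word (words_nonempty hf)

variable (K) in
/-- The polynomials all of whose words are smaller than `u`. -/
noncomputable def lowerPolynomials (u : FreeMonoid X) : Submodule K (FreeAlgebra K X) where
  carrier := {f | ∀ v, ¬ DegLexLT v u → coeffWord K v f = 0}
  zero_mem' v _ := map_zero _
  add_mem' hf hg v hv := by rw [map_add, hf v hv, hg v hv, add_zero]
  smul_mem' c f hf v hv := by rw [map_smul, hf v hv, smul_zero]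

theorem word_mem_lowerPolynomials {u v : List X}
    (h : DegLexLT (FreeMonoid.ofList v) (FreeMonoid.ofList u)) :
    word K v ∈ lowerPolynomials K (FreeMonoid.ofList u) := by
  intro w hw
  rw [coeffWord_word, if_neg]
  rintro rfl
  exact hw h

theorem isLeadingWord_word_add {u : List X} {r : FreeAlgebra K X}
    (hr : r ∈ lowerPolynomials K (FreeMonoid.ofList u)) :
    IsLeadingWord DegLexLT (word K u + r) (FreeMonoid.ofList u) := by
  refine ⟨?_, fun v hv hvu => ?_⟩
  · rw [mem_words, map_add, hr _ (DegLexLT.irrefl _), coeffWord_word]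
    simp
  · by_contra h
    rw [mem_words, map_add, hr _ h, coeffWord_word, if_neg] at hv
    · simp at hv
    · rintro rfl
      exact hvu rfl

theorem isLeadingWord_f' {i j : X} (hij : j < i) :
    IsLeadingWord DegLexLT (f' K i j) (FreeMonoid.ofList [i, j, j]) := by
  have e : f' K i j = word K [i, j, j] +
      (word K [j, j, i] - word K [j, i, j] - word K [j, i, j]) := by
    simp only [f', Ring.lie_def, word_cons, word_nil]
    noncomm_ring
  rw [e]
  refine isLeadingWord_word_add (sub_mem (sub_mem ?_ ?_) ?_) <;>
  exact word_mem_lowerPolynomials (by simp [degLexLT_iff, List.cons_lt_cons_iff, hij])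

theorem isLeadingWord_f'' {i j : X} (hij : j < i) :
    IsLeadingWord DegLexLT (f'' K i j) (FreeMonoid.ofList [i, i, j]) := by
  have e : f'' K i j = word K [i, i, j] +
      (word K [j, i, i] - word K [i, j, i] - word K [i, j, i]) := by
    simp only [f'', Ring.lie_def, word_cons, word_nil]
    noncomm_ring
  rw [e]
  refine isLeadingWord_word_add (sub_mem (sub_mem ?_ ?_) ?_) <;>
  exact word_mem_lowerPolynomials (by simp [degLexLT_iff, List.cons_lt_cons_iff, hij])

theorem isLeadingWord_g' {i j k : X} (hij : j < i) (hjk : k < j) :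
    IsLeadingWord DegLexLT (g' K i j k) (FreeMonoid.ofList [i, j, k]) := by
  have e : g' K i j k = word K [i, j, k] +
      (word K [k, j, i] - word K [i, k, j] - word K [j, k, i]) := by
    simp only [g', Ring.lie_def, word_cons, word_nil]
    noncomm_ring
  rw [e]
  refine isLeadingWord_word_add (sub_mem (sub_mem ?_ ?_) ?_) <;>
  exact word_mem_lowerPolynomials
    (by simp [degLexLT_iff, List.cons_lt_cons_iff, hij, hjk, hjk.trans hij])

theorem isLeadingWord_g'' {i j k : X} (hij : j < i) (hjk : k < j) :
    IsLeadingWord DegLexLT (g'' K i k j) (FreeMonoid.ofList [i, k, j]) := by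
  have e : g'' K i k j = word K [i, k, j] +
      (word K [j, k, i] - word K [k, i, j] - word K [j, i, k]) := by
    simp only [g'', Ring.lie_def, word_cons, word_nil]
    noncomm_ring
  rw [e]
  refine isLeadingWord_word_add (sub_mem (sub_mem ?_ ?_) ?_) <;>
  exact word_mem_lowerPolynomials
    (by simp [degLexLT_iff, List.cons_lt_cons_iff, hij, hjk.trans hij])

theorem isLeadingWord_h {i j k : X} (hij : j < i) (hjk : k < j) :
    IsLeadingWord DegLexLT (h K i j k) (FreeMonoid.ofList [i, j, i, k]) := by
  have e : h K i j k = word K [i, j, i, k] +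
      (word K [j, i, k, i] + word K [i, k, j, i] + word K [k, i, i, j] - word K [i, j, k, i]
        - word K [j, i, i, k] - word K [i, k, i, j] - word K [k, i, j, i]) := by
    simp only [h, Ring.lie_def, word_cons, word_nil]
    noncomm_ring
  rw [e]
  refine isLeadingWord_word_add (sub_mem (sub_mem (sub_mem (sub_mem
    (add_mem (add_mem ?_ ?_) ?_) ?_) ?_) ?_) ?_) <;>
  exact word_mem_lowerPolynomials
    (by simp [degLexLT_iff, List.cons_lt_cons_iff, hij, hjk, hjk.trans hij])

end Order

/-! ### The ideal generated by γ₃(L), from inside and from outside -/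

section IdealMembership

attribute [local instance 100] LieRing.ofAssociativeRing

variable {K X : Type*} [Field K]

theorem ι_mem_freeLie (i : X) : FreeAlgebra.ι K i ∈ freeLie K X :=
  LieSubalgebra.subset_lieSpan (Set.mem_range_self i)

theorem lie_lie_mem_gammaThreeIdeal {a b c : FreeAlgebra K X} (ha : a ∈ freeLie K X)
    (hb : b ∈ freeLie K X) (hc : c ∈ freeLie K X) : ⁅a, ⁅b, c⁆⁆ ∈ gammaThreeIdeal K X := by
  refine TwoSidedIdeal.subset_span
    ⟨⁅(⟨a, ha⟩ : freeLie K X), ⁅(⟨b, hb⟩ : freeLie K X), (⟨c, hc⟩ : freeLie K X)⁆⁆, ?_, rfl⟩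
  rw [SetLike.mem_coe, LieModule.lowerCentralSeries_succ, LieModule.lowerCentralSeries_succ,
    LieModule.lowerCentralSeries_zero]
  exact LieSubmodule.lie_mem_lie trivial (LieSubmodule.lie_mem_lie trivial trivial)

theorem lie_lie_mem_gammaThreeIdeal' {a b c : FreeAlgebra K X} (ha : a ∈ freeLie K X)
    (hb : b ∈ freeLie K X) (hc : c ∈ freeLie K X) : ⁅⁅a, b⁆, c⁆ ∈ gammaThreeIdeal K X := by
  rw [← lie_skew]
  exact neg_mem (lie_lie_mem_gammaThreeIdeal hc ha hb)

theorem commutators_subset_gammaThreeIdeal [LinearOrder X] {p : FreeAlgebra K X}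
    (hp : p ∈ commutators K X) : p ∈ gammaThreeIdeal K X := by
  rcases hp with ⟨i, j, -, rfl | rfl⟩ | ⟨i, j, k, -, -, rfl | rfl | rfl⟩
  · exact lie_lie_mem_gammaThreeIdeal' (ι_mem_freeLie _) (ι_mem_freeLie _) (ι_mem_freeLie _)
  · exact lie_lie_mem_gammaThreeIdeal (ι_mem_freeLie _) (ι_mem_freeLie _) (ι_mem_freeLie _)
  · exact lie_lie_mem_gammaThreeIdeal (ι_mem_freeLie _) (ι_mem_freeLie _) (ι_mem_freeLie _)
  · exact lie_lie_mem_gammaThreeIdeal' (ι_mem_freeLie _) (ι_mem_freeLie _) (ι_mem_freeLie _)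
  · exact lie_lie_mem_gammaThreeIdeal
      ((freeLie K X).lie_mem (ι_mem_freeLie _) (ι_mem_freeLie _)) (ι_mem_freeLie _)
      (ι_mem_freeLie _)

/-- An algebra homomorphism under which the commutators of variables become central kills the
ideal generated by `γ₃(L)`. -/
theorem map_eq_zero_of_mem_gammaThreeIdeal {B : Type*} [Ring B] [Algebra K B]
    (φ : FreeAlgebra K X →ₐ[K] B)
    (hφ : ∀ i j k : X, ⁅φ (FreeAlgebra.ι K k), ⁅φ (FreeAlgebra.ι K i), φ (FreeAlgebra.ι K j)⁆⁆ = 0)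
    {f : FreeAlgebra K X} (hf : f ∈ gammaThreeIdeal K X) : φ f = 0 := by
  -- By the Jacobi identity, commuting with the generators implies commuting with all of L.
  have central {z : B} (hz : ∀ k, ⁅φ (FreeAlgebra.ι K k), z⁆ = 0) {a : FreeAlgebra K X}
      (ha : a ∈ freeLie K X) : ⁅φ a, z⁆ = 0 := by
    induction ha using LieSubalgebra.lieSpan_induction with
    | mem _ h => obtain ⟨k, rfl⟩ := h; exact hz k
    | zero => simp
    | add _ _ _ _ h h' => rw [map_add, add_lie, h, h', add_zero]
    | smul c _ _ h =>
      rw [Ring.lie_def] at h ⊢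
      rw [map_smul, smul_mul_assoc, mul_smul_comm, ← smul_sub, h, smul_zero]
    | lie a b _ _ h h' =>
      have e : φ ⁅a, b⁆ = ⁅φ a, φ b⁆ := by simp [Ring.lie_def]
      rw [e, lie_lie, h, h', lie_zero, lie_zero, sub_zero]
  have ι_lie {j : X} {a : FreeAlgebra K X} (ha : a ∈ freeLie K X) :
      ∀ k, ⁅φ (FreeAlgebra.ι K k), ⁅φ a, φ (FreeAlgebra.ι K j)⁆⁆ = 0 := by
    induction ha using LieSubalgebra.lieSpan_induction with
    | mem _ h => obtain ⟨i, rfl⟩ := h; exact hφ i j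
    | zero => simp
    | add _ _ _ _ h h' => intro k; rw [map_add, add_lie, lie_add, h, h', add_zero]
    | smul c a _ h =>
      intro k
      have e : ⁅φ (c • a), φ (FreeAlgebra.ι K j)⁆ = c • ⁅φ a, φ (FreeAlgebra.ι K j)⁆ := by
        simp [Ring.lie_def, smul_sub]
      have h := h k
      rw [e, Ring.lie_def, smul_mul_assoc, mul_smul_comm, ← smul_sub, ← Ring.lie_def, h,
        smul_zero]
    -- Jacobi turns [[a, b], x_j] into [a, [b, x_j]] - [b, [a, x_j]]; the inner brackets are central
    -- by induction, so both terms vanish.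
    | lie a b ha hb h h' =>
      intro k
      have e : φ ⁅a, b⁆ = ⁅φ a, φ b⁆ := by simp [Ring.lie_def]
      rw [e, lie_lie, central h' ha, central h hb, sub_zero, lie_zero]
  have lie_lie_eq_zero {a b : FreeAlgebra K X} (ha : a ∈ freeLie K X) (hb : b ∈ freeLie K X) :
      ∀ k, ⁅φ (FreeAlgebra.ι K k), ⁅φ a, φ b⁆⁆ = 0 := by
    induction hb using LieSubalgebra.lieSpan_induction with
    | mem _ h => obtain ⟨i, rfl⟩ := h; exact ι_lie ha
    | zero => simp
    | add _ _ _ _ h h' => intro k; rw [map_add, lie_add, lie_add, h, h', add_zero]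
    | smul c b _ h =>
      intro k
      have e : ⁅φ a, φ (c • b)⁆ = c • ⁅φ a, φ b⁆ := by
        simp [Ring.lie_def, smul_sub]
      have h := h k
      rw [e, Ring.lie_def, smul_mul_assoc, mul_smul_comm, ← smul_sub, ← Ring.lie_def, h,
        smul_zero]
    | lie b c hb hc h h' =>
      intro k
      have e : φ ⁅b, c⁆ = ⁅φ b, φ c⁆ := by simp [Ring.lie_def]
      have h1 : ⁅⁅φ a, φ b⁆, φ c⁆ = 0 := by rw [← lie_skew, central h hc, neg_zero]
      rw [e, leibniz_lie (φ a), h1, central h' hb, add_zero, lie_zero]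
  have key : gammaThreeIdeal K X ≤ TwoSidedIdeal.ker φ := by
    refine TwoSidedIdeal.span_le.mpr ?_
    rintro _ ⟨a, ha, rfl⟩
    let ψ : freeLie K X →ₗ⁅K⁆ B :=
      { toFun := fun a => φ a
        map_add' := fun a b => by simp
        map_smul' := fun c a => by simp
        map_lie' := fun {a b} => by simp [Ring.lie_def] }
    -- The elements with central image: [L, L] lies here, so one more bracket lands in the kernel.
    let N : LieSubmodule K (freeLie K X) (freeLie K X) :=
      { carrier := {a | ∀ k, ⁅φ (FreeAlgebra.ι K k), φ a⁆ = 0}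
        zero_mem' := fun k => by simp
        add_mem' := fun {a b} h h' k => by
          rw [AddMemClass.coe_add, map_add, lie_add, h, h', add_zero]
        smul_mem' := fun c a h k => by
          have h := h k
          rw [Ring.lie_def] at h
          rw [SetLike.val_smul, map_smul, Ring.lie_def, smul_mul_assoc, mul_smul_comm,
            ← smul_sub, h, smul_zero]
        lie_mem := fun {a b} _ k => by
          have e : φ (⁅a, b⁆ : freeLie K X) = ⁅φ a, φ b⁆ := by simp [Ring.lie_def]
          rw [e]
          exact lie_lie_eq_zero a.2 b.2 k }
    have h1 : LieModule.lowerCentralSeries K (freeLie K X) (freeLie K X) 1 ≤ N := by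
      rw [LieModule.lowerCentralSeries_succ, LieSubmodule.lie_le_iff]
      intro a _ b _ k
      have e : φ (⁅a, b⁆ : freeLie K X) = ⁅φ a, φ b⁆ := by simp [Ring.lie_def]
      rw [e]
      exact lie_lie_eq_zero a.2 b.2 k
    have h2 : LieModule.lowerCentralSeries K (freeLie K X) (freeLie K X) 2 ≤ ψ.ker := by
      rw [LieModule.lowerCentralSeries_succ, LieSubmodule.lie_le_iff]
      intro a _ b hb
      rw [LieHom.mem_ker, LieHom.map_lie]
      exact central (h1 hb) a.2
    exact (TwoSidedIdeal.mem_ker φ).mpr (h2 ha)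
  exact (TwoSidedIdeal.mem_ker φ).mp (key hf)

end IdealMembership

open MvPolynomial

/-! ### Grading of the model -/

section Monomials

variable {X : Type*}

/-- The variables of the model: `Sum.inl i` stands for `x_i`, and `Sum.inr (i, j)` stands for the
central element `[x_i, x_j]`. -/
abbrev ModelVar (X : Type*) := X ⊕ X × X

/-- The degree of a monomial of the model, with `[x_i, x_j]` of degree two. -/
noncomputable def modelDegree : (ModelVar X →₀ ℕ) →+ ℕ :=
  Finsupp.weight (Sum.elim (fun _ => 1) fun _ => 2)

@[simp]
theorem modelDegree_single_inl (i : X) : modelDegree (Finsupp.single (.inl i) 1) = 1 := by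
  simp [modelDegree, Finsupp.weight_single]

@[simp]
theorem modelDegree_single_inr (p : X × X) : modelDegree (Finsupp.single (.inr p) 1) = 2 := by
  simp [modelDegree, Finsupp.weight_single]

end Monomials

/-! ### The representation on the model -/

section Model

variable {K X : Type*} [Field K] [LinearOrder X]

variable (K) in
/-- The derivation sending `x_j` to `[x_i, x_j]` for `j < i` and all other variables to zero. -/
noncomputable def commDerivation (i : X) :
    Derivation K (MvPolynomial (ModelVar X) K) (MvPolynomial (ModelVar X) K) :=
  mkDerivation K (Sum.elim (fun j => if j < i then MvPolynomial.X (.inr (i, j)) else 0) fun _ => 0)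

@[simp]
theorem commDerivation_X_inl (i j : X) : commDerivation K i (MvPolynomial.X (.inl j)) =
    if j < i then MvPolynomial.X (.inr (i, j)) else 0 := by
  simp [commDerivation]

@[simp]
theorem commDerivation_X_inr (i : X) (p : X × X) : commDerivation K i (MvPolynomial.X (.inr p)) = 0 := by
  simp [commDerivation]

/-- Both composites kill every variable, since the c's are constants for the derivations. -/
theorem commDerivation_comm (i j : X) (p : MvPolynomial (ModelVar X) K) :
    commDerivation K i (commDerivation K j p) = commDerivation K j (commDerivation K i p) := by
  have h : ⁅commDerivation K i, commDerivation K j⁆ = 0 := by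
    refine derivation_ext fun v => ?_
    rcases v with k | v
    · simp only [Derivation.commutator_apply, commDerivation_X_inl, Derivation.coe_zero,
        Pi.zero_apply]
      split_ifs <;> simp
    · simp [Derivation.commutator_apply]
  have := congrArg (fun D => D p) h
  simpa [Derivation.commutator_apply, sub_eq_zero] using this

variable (K) in
/-- Left multiplication by `x_i`, as an operator on the ordered monomials of the model. -/
noncomputable def letterOp (i : X) : Module.End K (MvPolynomial (ModelVar X) K) :=
  LinearMap.mulLeft K (MvPolynomial.X (.inl i)) + (commDerivation K i).toLinearMap

theorem letterOp_apply (i : X) (p : MvPolynomial (ModelVar X) K) :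
    letterOp K i p = MvPolynomial.X (.inl i) * p + commDerivation K i p := rfl

/-- The second-order terms cancel because the derivations commute; Leibniz leaves only a
multiplication operator. -/
theorem lie_letterOp_apply (i j : X) (p : MvPolynomial (ModelVar X) K) :
    ⁅letterOp K i, letterOp K j⁆ p =
      (commDerivation K i (MvPolynomial.X (.inl j)) - commDerivation K j (MvPolynomial.X (.inl i))) * p := by
  simp only [Ring.lie_def, LinearMap.sub_apply, Module.End.mul_apply, letterOp_apply, map_add,
    Derivation.leibniz, smul_eq_mul, commDerivation_comm i j p]
  ring

theorem lie_letterOp_lie_letterOp (i j k : X) :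
    ⁅letterOp K k, ⁅letterOp K i, letterOp K j⁆⁆ = 0 := by
  refine LinearMap.ext fun p => ?_
  have hz : commDerivation K k
      (commDerivation K i (MvPolynomial.X (.inl j)) - commDerivation K j (MvPolynomial.X (.inl i))) = 0 := by
    simp only [commDerivation_X_inl, map_sub]
    split_ifs <;> simp
  rw [Ring.lie_def, LinearMap.sub_apply, Module.End.mul_apply, Module.End.mul_apply,
    lie_letterOp_apply, lie_letterOp_apply, letterOp_apply, letterOp_apply,
    Derivation.leibniz, hz]
  simp only [smul_eq_mul, LinearMap.zero_apply]
  ring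

variable (K X) in
/-- The representation of `K⟨X⟩` on the model. -/
noncomputable def modelHom : FreeAlgebra K X →ₐ[K] Module.End K (MvPolynomial (ModelVar X) K) :=
  FreeAlgebra.lift K (letterOp K)

theorem modelHom_eq_zero {f : FreeAlgebra K X} (hf : f ∈ gammaThreeIdeal K X) :
    modelHom K X f = 0 :=
  map_eq_zero_of_mem_gammaThreeIdeal _
    (fun i j k => by simpa [modelHom] using lie_letterOp_lie_letterOp i j k) hf

variable (K) in
/-- The image of a word in the model. -/
noncomputable def wordImage (w : List X) : MvPolynomial (ModelVar X) K :=
  modelHom K X (word K w) 1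

@[simp]
theorem wordImage_nil : wordImage K ([] : List X) = 1 := by
  simp [wordImage]

theorem wordImage_cons (i : X) (w : List X) : wordImage K (i :: w) =
    MvPolynomial.X (.inl i) * wordImage K w + commDerivation K i (wordImage K w) := by
  simp [wordImage, modelHom, letterOp_apply]

/-- The derivation trades one factor x_l for c_{il}. The trade is written additively to avoid
truncated subtraction of exponents. -/
theorem exists_of_coeff_commDerivation_ne_zero {i : X} {p : MvPolynomial (ModelVar X) K}
    {m : ModelVar X →₀ ℕ} (h : coeff m (commDerivation K i p) ≠ 0) :
    ∃ n, coeff n p ≠ 0 ∧ ∃ l < i,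
      n + Finsupp.single (.inr (i, l)) 1 = m + Finsupp.single (.inl l) 1 := by
  rw [p.as_sum, map_sum, coeff_sum] at h
  obtain ⟨n, hn, h⟩ := Finset.exists_ne_zero_of_sum_ne_zero h
  refine ⟨n, mem_support_iff.mp hn, ?_⟩
  rw [commDerivation, mkDerivation_monomial, coeff_smul, Finsupp.sum, coeff_sum] at h
  obtain ⟨v, hv, h⟩ := Finset.exists_ne_zero_of_sum_ne_zero (right_ne_zero_of_smul h)
  rcases v with l | v
  · simp only [Sum.elim_inl, smul_eq_mul] at h
    split_ifs at h with hl
    · refine ⟨l, hl, ?_⟩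
      rw [MvPolynomial.X, monomial_mul, coeff_monomial] at h
      have e := (ite_ne_right_iff.mp h).1
      have hle : Finsupp.single (.inl l) 1 ≤ n := by
        rw [Finsupp.single_le_iff]
        exact Nat.one_le_iff_ne_zero.mpr (Finsupp.mem_support_iff.mp hv)
      rw [← e, add_right_comm, tsub_add_cancel_of_le hle]
    · simp at h
  · simp at h

/-- In general differentiation contributes the exponent of x_j as a factor. Here `hn` makes that
exponent 1, and `huniq` excludes contributions from other monomials. -/
theorem coeff_commDerivation_eq {i j : X} (hj : j < i) {p : MvPolynomial (ModelVar X) K}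
    {n : ModelVar X →₀ ℕ} (hn : n (.inl j) = 0)
    (huniq : ∀ n', coeff n' p ≠ 0 → ∀ l < i, n' + Finsupp.single (.inr (i, l)) 1 =
      n + Finsupp.single (.inr (i, j)) 1 + Finsupp.single (.inl l) 1 → l = j) :
    coeff (n + Finsupp.single (.inr (i, j)) 1) (commDerivation K i p) =
      coeff (n + Finsupp.single (.inl j) 1) p := by
  set N := n + Finsupp.single (Sum.inl j) 1 with hN
  set c := coeff N p with hc
  have hp : p = (p - monomial N c) + monomial N c := by ring
  have h1 : coeff (n + Finsupp.single (.inr (i, j)) 1)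
      (commDerivation K i (p - monomial N c)) = 0 := by
    by_contra h
    obtain ⟨n', hn', l, hl, e⟩ := exists_of_coeff_commDerivation_ne_zero h
    rw [coeff_sub, coeff_monomial] at hn'
    by_cases hNn : N = n'
    · rw [if_pos hNn, ← hNn, hc, sub_self] at hn'
      exact hn' rfl
    · rw [if_neg hNn, sub_zero] at hn'
      obtain rfl := huniq n' hn' l hl e
      apply hNn
      rw [add_right_comm] at e
      exact (add_right_cancel e).symm
  have h2 : monomial N c = monomial n c * MvPolynomial.X (.inl j) := by
    rw [MvPolynomial.X, monomial_mul, mul_one]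
  rw [hp, map_add, coeff_add, h1, zero_add, h2, Derivation.leibniz, commDerivation_X_inl,
    if_pos hj, smul_eq_mul, smul_eq_mul, coeff_add, coeff_X_mul', if_neg, add_zero,
    MvPolynomial.X,    monomial_mul, coeff_monomial, if_pos rfl, mul_one]
  simp [hn]

theorem exists_of_coeff_wordImage_cons_ne_zero {i : X} {w : List X} {m : ModelVar X →₀ ℕ}
    (h : coeff m (wordImage K (i :: w)) ≠ 0) :
    ∃ n, coeff n (wordImage K w) ≠ 0 ∧ (m = n + Finsupp.single (.inl i) 1 ∨
      ∃ l < i, n + Finsupp.single (.inr (i, l)) 1 = m + Finsupp.single (.inl l) 1) := by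
  rw [wordImage_cons, coeff_add] at h
  by_cases h1 : coeff m (MvPolynomial.X (.inl i) * wordImage K w) = 0
  · rw [h1, zero_add] at h
    obtain ⟨n, hn, h⟩ := exists_of_coeff_commDerivation_ne_zero h
    exact ⟨n, hn, .inr h⟩
  · rw [coeff_X_mul'] at h1
    obtain ⟨h2, h3⟩ := ite_ne_right_iff.mp h1
    refine ⟨_, h3, .inl ?_⟩
    rw [tsub_add_cancel_of_le]
    rw [Finsupp.single_le_iff]
    exact Nat.one_le_iff_ne_zero.mpr (Finsupp.mem_support_iff.mp h2)

/-- The first letter of a word heads one of the variables in every monomial of its image. -/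
theorem head_mem_of_coeff_ne_zero {i : X} {w : List X} {m : ModelVar X →₀ ℕ}
    (h : coeff m (wordImage K (i :: w)) ≠ 0) :
    m (.inl i) ≠ 0 ∨ ∃ l, m (.inr (i, l)) ≠ 0 := by
  obtain ⟨n, -, rfl | ⟨l, -, e⟩⟩ := exists_of_coeff_wordImage_cons_ne_zero h
  · simp
  · have := DFunLike.congr_fun e (.inr (i, l))
    simp at this
    exact .inr ⟨l, by omega⟩

/-- Each letter raises the degree by one: it either multiplies by x_i or replaces x_l, of degree 1,
by c_{il}, of degree 2. -/
theorem length_eq_of_coeff_ne_zero {w : List X} {m : ModelVar X →₀ ℕ}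
    (h : coeff m (wordImage K w) ≠ 0) : w.length = modelDegree m := by
  induction w generalizing m with
  | nil =>
    rw [wordImage_nil, coeff_one] at h
    rw [← (ite_ne_right_iff.mp h).1, map_zero, List.length_nil]
  | cons i w ih =>
    obtain ⟨n, hn, rfl | ⟨l, -, e⟩⟩ := exists_of_coeff_wordImage_cons_ne_zero h
    · simp [ih hn]
    · have := congrArg modelDegree e
      simp only [map_add, modelDegree_single_inl, modelDegree_single_inr] at this
      rw [List.length_cons, ih hn]
      omega

/-! ### Least words of monomials -/

/-- Every variable `x_k` or `[x_k, x_l]` in the monomial `m` has `i ≤ k`. -/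
def HeadsGE (m : ModelVar X →₀ ℕ) (i : X) : Prop :=
  (∀ k, m (.inl k) ≠ 0 → i ≤ k) ∧ ∀ k l, m (.inr (k, l)) ≠ 0 → i ≤ k

theorem HeadsGE.le_head {m : ModelVar X →₀ ℕ} {i c : X} (hm : HeadsGE m i) {w : List X}
    (h : coeff m (wordImage K (c :: w)) ≠ 0) : i ≤ c :=
  (head_mem_of_coeff_ne_zero h).elim (hm.1 c) fun ⟨l, hl⟩ => hm.2 c l hl

theorem HeadsGE.add_inl {m : ModelVar X →₀ ℕ} {i j : X} (hm : HeadsGE m i) (hj : i ≤ j) :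
    HeadsGE (m + Finsupp.single (.inl j) 1) i := by
  refine ⟨fun k hk => ?_, fun k l hk => hm.2 k l (by simpa using hk)⟩
  by_cases e : j = k
  · exact e ▸ hj
  · exact hm.1 k (by simpa [Finsupp.single_apply, e] using hk)

theorem HeadsGE.add_inr {m : ModelVar X →₀ ℕ} {i j k : X} (hm : HeadsGE m i) (hj : i ≤ j) :
    HeadsGE (m + Finsupp.single (.inr (j, k)) 1) i := by
  refine ⟨fun k hk => hm.1 k (by simpa using hk), fun k' l hk => ?_⟩
  by_cases e : j = k'
  · exact e ▸ hj
  · exact hm.2 k' l (by simpa [Finsupp.single_apply, e] using hk)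

theorem HeadsGE.mono {m : ModelVar X →₀ ℕ} {i j : X} (hm : HeadsGE m i) (hj : j ≤ i) :
    HeadsGE m j :=
  ⟨fun k hk => hj.trans (hm.1 k hk), fun k l hk => hj.trans (hm.2 k l hk)⟩

theorem HeadsGE.of_add {m n : ModelVar X →₀ ℕ} {i : X} (hm : HeadsGE (m + n) i) : HeadsGE m i :=
  ⟨fun k hk => hm.1 k (by simp [hk]), fun k l hk => hm.2 k l (by simp [hk])⟩

/-- `LeastWord m w` says that `w` is the smallest word whose image contains the monomial `m`: it
lists the variables of `m` in increasing order, each `[x_i, x_j]` being spelled out as `x_i x_j`. -/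
inductive LeastWord : (ModelVar X →₀ ℕ) → List X → Prop
  | nil : LeastWord 0 []
  | single {m w i} : LeastWord m w → HeadsGE m i → (∀ l, m (.inr (i, l)) = 0) →
      LeastWord (m + Finsupp.single (.inl i) 1) (i :: w)
  | pair {m w i j} : LeastWord m w → HeadsGE m i → j < i → (∀ l, m (.inr (i, l)) ≠ 0 → j ≤ l) →
      LeastWord (m + Finsupp.single (.inr (i, j)) 1) (i :: j :: w)

theorem LeastWord.length_eq {m : ModelVar X →₀ ℕ} {w : List X} (h : LeastWord m w) :
    w.length = modelDegree m := by
  induction h with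
  | nil => simp
  | single _ _ _ ih => simp [ih]
  | pair _ _ _ _ ih => simp [ih]

/-- The derivation term always introduces some c_{il}, so only the multiplication by x_i can
contribute. -/
theorem coeff_wordImage_cons_of_forall_eq_zero {i : X} {w : List X} {m : ModelVar X →₀ ℕ}
    (hm : ∀ l, m (.inr (i, l)) = 0) :
    coeff (m + Finsupp.single (.inl i) 1) (wordImage K (i :: w)) = coeff m (wordImage K w) := by
  have h : coeff (m + Finsupp.single (.inl i) 1) (commDerivation K i (wordImage K w)) = 0 := by
    by_contra h
    obtain ⟨n, -, l, -, e⟩ := exists_of_coeff_commDerivation_ne_zero h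
    have := DFunLike.congr_fun e (.inr (i, l))
    simp [hm l] at this
  rw [wordImage_cons, coeff_add, h, add_zero, add_comm m, coeff_X_mul]

/-- If a variable of `m` is replaced by its second letter `l`, then a word whose image contains the
result starts with `l` or with a letter `≥ i`. -/
theorem HeadsGE.head_eq_or_le {m n : ModelVar X →₀ ℕ} {i l d : X} (hm : HeadsGE m i)
    (e : n + Finsupp.single (.inr (i, l)) 1 = m + Finsupp.single (.inl l) 1) {w : List X}
    (h : coeff n (wordImage K (d :: w)) ≠ 0) : d = l ∨ i ≤ d := by
  rcases head_mem_of_coeff_ne_zero h with h | ⟨k, h⟩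
  · by_cases hd : l = d
    · exact .inl hd.symm
    · have := DFunLike.congr_fun e (.inl d)
      simp [hd] at this
      exact .inr (hm.1 d (this ▸ h))
  · have := DFunLike.congr_fun e (.inr (d, k))
    simp only [Finsupp.add_apply, Finsupp.single_apply, reduceCtorEq, if_false, add_zero] at this
    exact .inr (hm.2 d k (by omega))

theorem LeastWord.coeff_eq_one {m : ModelVar X →₀ ℕ} {w : List X} (h : LeastWord m w) :
    coeff m (wordImage K w) = 1 := by
  induction h with
  | nil => simp
  | single _ _ hl ih => rw [coeff_wordImage_cons_of_forall_eq_zero hl, ih]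
  | @pair m w i j _ hm hj hl ih =>
    have hm' := hm.add_inr (k := j) le_rfl
    -- Cancelling x_i leaves a monomial with all heads ≥ i, while the image of `j :: w` needs the
    -- head j < i.
    have h1 : coeff (m + Finsupp.single (.inr (i, j)) 1)
        (MvPolynomial.X (.inl i) * wordImage K (j :: w)) = 0 := by
      rw [coeff_X_mul']
      split_ifs with hs
      · by_contra h
        have hle : Finsupp.single (.inl i) 1 ≤ m + Finsupp.single (.inr (i, j)) 1 := by
          rw [Finsupp.single_le_iff]
          exact Nat.one_le_iff_ne_zero.mpr (Finsupp.mem_support_iff.mp hs)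
        rw [← tsub_add_cancel_of_le hle] at hm'
        exact absurd (hm'.of_add.le_head h) hj.not_ge
      · rfl
    rw [wordImage_cons, coeff_add, h1, zero_add, coeff_commDerivation_eq hj,
      coeff_wordImage_cons_of_forall_eq_zero, ih]
    · intro l
      by_contra h
      exact absurd (hm.2 j l h) hj.not_ge
    · by_contra h
      exact absurd (hm.1 j h) hj.not_ge
    · intro n' hn' l _ e
      rcases hm'.head_eq_or_le e hn' with h | h
      · exact h.symm
      · exact absurd h hj.not_ge

theorem cons_le_cons_iff_of_linearOrder {i j : X} {v w : List X} :
    i :: v ≤ j :: w ↔ i < j ∨ i = j ∧ v ≤ w := by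
  rw [← not_lt, ← not_lt, List.cons_lt_cons_iff, not_or, not_and]
  rcases lt_trichotomy i j with h | rfl | h
  · simp [h, h.not_gt, h.ne']
  · simp
  · simp [h, h.not_gt, h.ne']

theorem LeastWord.le {m : ModelVar X →₀ ℕ} {w : List X} (h : LeastWord m w) {v : List X}
    (hv : coeff m (wordImage K v) ≠ 0) : w ≤ v := by
  have hlen := h.length_eq.trans (length_eq_of_coeff_ne_zero hv).symm
  induction h generalizing v with
  | nil => exact not_lt.mp (List.not_lt_nil v)
  | @single m w i _ hm hl ih =>
    obtain _ | ⟨c, v⟩ := v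
    · simp at hlen
    rcases ((hm.add_inl le_rfl).le_head hv).lt_or_eq with hc | rfl
    · exact cons_le_cons_iff_of_linearOrder.mpr (.inl hc)
    · rw [coeff_wordImage_cons_of_forall_eq_zero hl] at hv
      exact cons_le_cons_iff_of_linearOrder.mpr (.inr ⟨rfl, ih hv (by simpa using hlen)⟩)
  | @pair m w i j _ hm hj hl ih =>
    obtain _ | ⟨c, v⟩ := v
    · simp at hlen
    have hm' := hm.add_inr (k := j) le_rfl
    rcases (hm'.le_head hv).lt_or_eq with hc | rfl
    · exact cons_le_cons_iff_of_linearOrder.mpr (.inl hc)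
    refine cons_le_cons_iff_of_linearOrder.mpr (.inr ⟨rfl, ?_⟩)
    obtain _ | ⟨d, v⟩ := v
    · simp at hlen
    -- If i acted by multiplication, the second letter is ≥ i > j. Otherwise it is ≥ i or equals the
    -- traded letter l.
    obtain ⟨n, hn, e | ⟨l, hli, e⟩⟩ := exists_of_coeff_wordImage_cons_ne_zero hv
    · rw [e] at hm'
      exact cons_le_cons_iff_of_linearOrder.mpr (.inl (hj.trans_le (hm'.of_add.le_head hn)))
    · rcases hm'.head_eq_or_le e hn with rfl | h
      -- For d ≠ j the variable c_{id} created by the trade must already occur in m, where j is a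
      -- lower bound.
      · have hjd : j ≤ d := by
          by_cases hjd : j = d
          · exact hjd.le
          · refine hl d fun h0 => ?_
            have := DFunLike.congr_fun e (.inr (i, d))
            simp [h0, hjd] at this
        rcases hjd.lt_or_eq with hlt | rfl
        · exact cons_le_cons_iff_of_linearOrder.mpr (.inl hlt)
        · rw [add_right_comm] at e
          rw [add_right_cancel e, coeff_wordImage_cons_of_forall_eq_zero] at hn
          · exact cons_le_cons_iff_of_linearOrder.mpr (.inr ⟨rfl, ih hn (by simpa using hlen)⟩)
          · intro l
            by_contra h
            exact absurd (hm.2 j l h) hj.not_ge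
      · exact cons_le_cons_iff_of_linearOrder.mpr (.inl (hj.trans_le h))

end Model

/-! ### Words avoiding the leading words, and the conclusion -/

section Reduced

variable {K X : Type*} [Field K] [LinearOrder X]

/-- The leading words of the commutators in the Gröbner basis. -/
inductive CommutatorLeadingWord : List X → Prop
  | f' {i j} : j < i → CommutatorLeadingWord [i, j, j]
  | f'' {i j} : j < i → CommutatorLeadingWord [i, i, j]
  | g' {i j k} : j < i → k < j → CommutatorLeadingWord [i, j, k]
  | g'' {i j k} : j < i → k < j → CommutatorLeadingWord [i, k, j]
  | h {i j k} : j < i → k < j → CommutatorLeadingWord [i, j, i, k]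

theorem CommutatorLeadingWord.exists_isLeadingWord {u : List X} (hu : CommutatorLeadingWord u) :
    ∃ g ∈ commutators K X, IsLeadingWord DegLexLT g (FreeMonoid.ofList u) := by
  cases hu with
  | f' hij => exact ⟨_, .inl ⟨_, _, hij, .inl rfl⟩, isLeadingWord_f' hij⟩
  | f'' hij => exact ⟨_, .inl ⟨_, _, hij, .inr rfl⟩, isLeadingWord_f'' hij⟩
  | g' hij hjk => exact ⟨_, .inr ⟨_, _, _, hij, hjk, .inl rfl⟩, isLeadingWord_g' hij hjk⟩
  | g'' hij hjk =>
    exact ⟨_, .inr ⟨_, _, _, hij, hjk, .inr (.inl rfl)⟩, isLeadingWord_g'' hij hjk⟩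
  | h hij hjk => exact ⟨_, .inr ⟨_, _, _, hij, hjk, .inr (.inr rfl)⟩, isLeadingWord_h hij hjk⟩

theorem LeastWord.headsGE {m : ModelVar X →₀ ℕ} {i : X} {w : List X}
    (h : LeastWord m (i :: w)) : HeadsGE m i := by
  cases h with
  | single _ hm _ => exact hm.add_inl le_rfl
  | pair _ hm _ _ => exact hm.add_inr le_rfl

/-- If `[x_i, x_l]` occurs in a monomial whose least word starts with `i`, then this word starts
with a pair `i j` where `j ≤ l`. -/
theorem LeastWord.exists_eq_cons_of_ne_zero {m : ModelVar X →₀ ℕ} {i : X} {w : List X}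
    (h : LeastWord m (i :: w)) {l : X} (hl : m (.inr (i, l)) ≠ 0) :
    ∃ j w', j < i ∧ j ≤ l ∧ w = j :: w' := by
  cases h with
  | single _ hm h0 => simp [h0 l] at hl
  | @pair m w _ j _ hm hj hle =>
    refine ⟨j, w, hj, ?_, rfl⟩
    by_cases e : j = l
    · exact e.le
    · exact hle l (by simpa [Finsupp.single_apply, e] using hl)

/-- Parse from the left: a descent i > j is read as c_{ij}, any other first letter as x_i. Each
failure of the ordering conditions of `LeastWord` exhibits a forbidden subword. -/
theorem exists_leastWord : ∀ w : List X, (∀ u, CommutatorLeadingWord u → ¬ u <:+: w) →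
    ∃ m, LeastWord m w
  | [], _ => ⟨0, .nil⟩
  | [i], _ => ⟨_, .single .nil ⟨by simp, by simp⟩ (by simp)⟩
  | i :: j :: w, hw => by
    rcases le_or_gt i j with hij | hij
    · obtain ⟨m, hm⟩ := exists_leastWord (j :: w) fun u hu h =>
        hw u hu (h.trans (List.suffix_cons _ _).isInfix)
      refine ⟨_, .single hm (hm.headsGE.mono hij) fun l => ?_⟩
      by_contra hl
      -- A factor c_{il} would make the remaining word begin with i k, k < i, giving the forbidden i
      -- i k.
      obtain rfl := le_antisymm hij (hm.headsGE.2 i l hl)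
      obtain ⟨k, w', hk, -, rfl⟩ := hm.exists_eq_cons_of_ne_zero hl
      exact hw _ (.f'' hk) ⟨[], w', rfl⟩
    · obtain ⟨m, hm⟩ := exists_leastWord w fun u hu h =>
        hw u hu (h.trans ((List.suffix_cons _ _).trans (List.suffix_cons _ _)).isInfix)
      obtain _ | ⟨k, w⟩ := w
      · obtain rfl : m = 0 := by cases hm; rfl
        exact ⟨_, .pair hm ⟨by simp, by simp⟩ hij (by simp)⟩
      have hik : i ≤ k := by
        by_contra! hki
        rcases lt_trichotomy j k with h | rfl | h
        · exact hw _ (.g'' hki h) ⟨[], w, rfl⟩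
        · exact hw _ (.f' hij) ⟨[], w, rfl⟩
        · exact hw _ (.g' hij h) ⟨[], w, rfl⟩
      refine ⟨_, .pair hm (hm.headsGE.mono hik) hij fun l hl => ?_⟩
      -- A factor c_{il} with l < j would make the word begin with i j i k', where k' ≤ l < j, a
      -- leading word of type h.
      obtain rfl := le_antisymm hik (hm.headsGE.2 i l hl)
      obtain ⟨k, w', hk, hkl, rfl⟩ := hm.exists_eq_cons_of_ne_zero hl
      by_contra! h
      exact hw _ (.h hij (hkl.trans_lt h)) ⟨[], w', rfl⟩

theorem exists_commutatorLeadingWord_infix {f : FreeAlgebra K X} (hf : f ∈ gammaThreeIdeal K X)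
    {w : FreeMonoid X} (hw : IsLeadingWord DegLexLT f w) :
    ∃ u, CommutatorLeadingWord u ∧ u <:+: w.toList := by
  by_contra! hred
  obtain ⟨m, hm⟩ := exists_leastWord w.toList hred
  have h0 : coeff m (modelHom K X f 1) = 0 := by rw [modelHom_eq_zero hf]; simp
  rw [sum_words f] at h0
  simp only [map_sum, map_smul, LinearMap.sum_apply, LinearMap.smul_apply, coeff_sum,
    coeff_smul] at h0
  -- All other words of f are deg-lex smaller than w, so none of their images contains m.
  rw [Finset.sum_eq_single_of_mem w hw.1] at h0
  · change coeffWord K w f • coeff m (wordImage K w.toList) = 0 at h0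
    rw [hm.coeff_eq_one, smul_eq_mul, mul_one] at h0
    exact mem_words.mp hw.1 h0
  · intro v hv hvw
    change coeffWord K v f • coeff m (wordImage K v.toList) = 0
    by_contra h
    have hc := right_ne_zero_of_smul h
    have hlen := hm.length_eq.trans (length_eq_of_coeff_ne_zero hc).symm
    rcases degLexLT_iff.mp (hw.2 v hv hvw) with h | ⟨-, h⟩
    · omega
    · exact absurd (hm.le hc) (not_le.mpr h)

end Reduced

end FreeNilpotentGroebner

theorem proposition3p2 (K : Type*) [Field K] (X : Type*) [LinearOrder X] [WellFoundedLT X] :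
    FreeNilpotentGroebner.IsGroebnerBasis FreeNilpotentGroebner.DegLexLT
      (FreeNilpotentGroebner.commutators K X)
      (FreeNilpotentGroebner.gammaThreeIdeal K X) := by
  refine ⟨fun g => FreeNilpotentGroebner.commutators_subset_gammaThreeIdeal, fun f hf hf0 => ?_⟩
  obtain ⟨w, hw⟩ := FreeNilpotentGroebner.exists_isLeadingWord hf0
  obtain ⟨u, hu, a, b, e⟩ := FreeNilpotentGroebner.exists_commutatorLeadingWord_infix hf hw
  obtain ⟨g, hg, hgu⟩ := hu.exists_isLeadingWord (K := K)
  exact ⟨w, hw, g, hg, _, hgu, FreeMonoid.ofList a, FreeMonoid.ofList b, e.symm⟩
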